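/- **Notation.** For real $k>0$ and $w\in\mathbb C$ the square root $\sqrt{k^2-w^2}$ is taken on the branch $$\sqrt{k^2-w^2}=-\mathrm i\sqrt{r_1r_2}\,e^{\mathrm i(\theta_1+\theta_2)/2},\qquad w+k=r_1e^{\mathrm i\theta_1},\quad w-k=r_2e^{\mathrm i\theta_2},\quad \theta_1,\theta_2\in(-\pi,\pi],$$ and accordingly $\sqrt{w^2-k^2}:=\mathrm i\sqrt{k^2-w^2}=\sqrt{r_1r_2}\,e^{\mathrm i(\theta_1+\theta_2)/2}$. Let $P_n$ be the Legendre polynomials. For $w\in\mathbb C$, a number $s$ with $s^2=1-w^2$, and integers $0\le m\le n$ put $P_n^m(w;s)=(-1)^m s^mP_n^{(m)}(w)$, where $P_n^{(m)}$ is the $m$-th derivative, and $P_n^{-m}(w;s)=(-1)^m\frac{(n-m)!}{(n+m)!}P_n^m(w;s)$. For $-n\le m\le n$ let $$\widehat P_n^m(w;s)=(-1)^m\sqrt{\tfrac{2n+1}{4\pi}\tfrac{(n-m)!}{(n+m)!}}\,P_n^m(w;s),\qquad \widehat P_n^m(w)=\widehat P_n^m\big(w;\sqrt{1-w^2}\big),\qquad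 Y_n^m(\theta,\varphi)=\widehat P_n^m(\cos\theta)e^{\mathrm im\varphi},$$ with $\sqrt{1-w^2}$ on the above branch. Let $i_n(x)=\sqrt{\frac{\pi}{2x}}\,I_{n+1/2}(x)$ be the modified spherical Bessel function of the first kind (extended continuously to $x=0$). **Proposition.** Let $\lambda>0$, $\alpha\in[0,2\pi)$, let $\boldsymbol r\in\mathbb R^3$ have spherical coordinates $(r,\theta,\varphi)$, with $r\ge 0$, polar angle $\theta\in[0,\pi]$ and azimuthal angle $\varphi$, and put $$B_n^m(\boldsymbol r)=4\pi(-1)^n i_n(\lambda r)Y_n^m(\theta,\varphi).$$ Let $\lambda_\rho\in\mathbb C$ be arbitrary and let $\lambda_z=\sqrt{\lambda^2+\lambda_\rho^2}$ be either of the two square roots. For $\rho\in\mathbb C$ write $\boldsymbol\lambda(\rho)=(\mathrm i\rho\cos\alpha,\ \mathrm i\rho\sin\alpha,\ -\lambda_z)$ and $\boldsymbol\lambda(\rho)\cdot\boldsymbol r=\sum_j\boldsymbol\lambda(\rho)_jr_j$. 1. With the branch chosen above for $\sqrt{\lambda_z^2-\lambda^2}$ in the exponential and for the square root in $\widehat P_n^m(\lambda_z/\lambda)$,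 i.e. with $\boldsymbol\lambda=\boldsymbol\lambda\big(\sqrt{\lambda_z^2-\lambda^2}\big)$, $$e^{\boldsymbol\lambda\cdot\boldsymbol r}=\sum_{n=0}^\infty\sum_{m=-n}^n\overline{B_n^m(\boldsymbol r)}\,\widehat P_n^m\Big(\frac{\lambda_z}{\lambda}\Big)e^{\mathrm im\alpha}=\sum_{n=0}^\infty\sum_{m=-n}^nB_n^m(\boldsymbol r)\,\widehat P_n^m\Big(\frac{\lambda_z}{\lambda}\Big)e^{-\mathrm im\alpha}.$$ 2. The same two expansions hold with $\boldsymbol\lambda=\boldsymbol\lambda(\lambda_\rho)=(\mathrm i\lambda_\rho\cos\alpha,\mathrm i\lambda_\rho\sin\alpha,-\lambda_z)$ if $\widehat P_n^m(\lambda_z/\lambda)$ is replaced by $\widehat P_n^m\big(\frac{\lambda_z}{\lambda};-\mathrm i\frac{\lambda_\rho}{\lambda}\big)$; this is $\widehat P_n^m(\lambda_z/\lambda)$ itself whenever $\lambda_\rho=\sqrt{\lambda_z^2-\lambda^2}$ on the branch, in particular when $\lambda_\rho>0$ and $\lambda_z>0$. All series in $n$ (with the inner sum over $m$ taken first) converge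 absolutely. -/

import Mathlib

namespace FunkHecke

noncomputable section

/-- The branch of `√(k² - w²)`, for real `k` and complex `w`: it equals
`-i √(r₁ r₂) exp (i (θ₁ + θ₂) / 2)`, where `r₁, r₂` are the moduli and `θ₁, θ₂ ∈ (-π, π]` the
principal arguments of `w + k` and `w - k`. -/
def branchSqrt (k : ℝ) (w : ℂ) : ℂ :=
  -Complex.I * (Real.sqrt (‖w + k‖ * ‖w - k‖) : ℂ) *
    Complex.exp (Complex.I * (((w + k).arg + (w - k).arg) / 2 : ℝ))

theorem branchSqrt_sq (k : ℝ) (w : ℂ) : branchSqrt k w ^ 2 = (k : ℂ) ^ 2 - w ^ 2 := by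
  have h1 := Complex.norm_mul_exp_arg_mul_I (w + k)
  have h2 := Complex.norm_mul_exp_arg_mul_I (w - k)
  have hs : ((Real.sqrt (‖w + k‖ * ‖w - k‖) : ℝ) : ℂ) ^ 2 = (‖w + k‖ : ℂ) * (‖w - k‖ : ℂ) := by
    rw [← Complex.ofReal_pow, Real.sq_sqrt (by positivity), Complex.ofReal_mul]
  have he : Complex.exp (Complex.I * (((w + k).arg + (w - k).arg) / 2 : ℝ)) ^ 2 =
      Complex.exp ((w + k).arg * Complex.I) * Complex.exp ((w - k).arg * Complex.I) := by
    rw [← Complex.exp_nat_mul, ← Complex.exp_add]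
    congr 1
    push_cast
    ring
  calc branchSqrt k w ^ 2
      = Complex.I ^ 2 * ((Real.sqrt (‖w + k‖ * ‖w - k‖) : ℝ) : ℂ) ^ 2 *
          Complex.exp (Complex.I * (((w + k).arg + (w - k).arg) / 2 : ℝ)) ^ 2 := by
        unfold branchSqrt; ring
    _ = -((‖w + k‖ : ℂ) * Complex.exp ((w + k).arg * Complex.I)) *
          ((‖w - k‖ : ℂ) * Complex.exp ((w - k).arg * Complex.I)) := by
        rw [hs, he, Complex.I_sq]; ring
    _ = (k : ℂ) ^ 2 - w ^ 2 := by rw [h1, h2]; ring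

/-- The Legendre polynomial `P_n`, by Rodrigues' formula. -/
def legendreP (n : ℕ) : Polynomial ℂ :=
  Polynomial.C ((2 ^ n * n.factorial : ℂ)⁻¹) *
    Polynomial.derivative^[n] ((Polynomial.X ^ 2 - 1) ^ n)

/-- The associated Legendre function `P_n^m` at `w`, where `s` is the chosen value of `√(1 - w²)`:
`P_n^m(w) = (-1)^m s^m P_n^{(m)}(w)` for `m ≥ 0`, and
`P_n^{-m} = (-1)^m (n - m)! / (n + m)! P_n^m` (used for `-n ≤ m ≤ n` only). -/
def assocLegendre (n : ℕ) (m : ℤ) (s w : ℂ) : ℂ :=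
  let k := m.natAbs
  let p := (-1) ^ k * s ^ k * (Polynomial.derivative^[k] (legendreP n)).eval w
  if 0 ≤ m then p else (-1) ^ k * ((n - k).factorial / (n + k).factorial : ℂ) * p

/-- The normalized associated Legendre function
`(-1)^m √((2n+1)/(4π) (n-m)!/(n+m)!) P_n^m` at `w`, where `s` is the chosen value of `√(1 - w²)`
(used for `-n ≤ m ≤ n` only, so that `toNat` loses nothing). -/
def normLegendreAt (n : ℕ) (m : ℤ) (s w : ℂ) : ℂ :=
  (-1) ^ m *
    (Real.sqrt ((2 * n + 1) / (4 * Real.pi) *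
      (((n - m).toNat.factorial : ℝ) / ((n + m).toNat.factorial : ℝ))) : ℂ) *
    assocLegendre n m s w

/-- The normalized associated Legendre function `P̂_n^m(w)` on the complex plane, with `√(1 - w²)`
on the branch `branchSqrt`. -/
def normLegendre (n : ℕ) (m : ℤ) (w : ℂ) : ℂ :=
  normLegendreAt n m (branchSqrt 1 w) w

/-- The spherical harmonic `Y_n^m(θ, φ) = P̂_n^m(cos θ) e^{imφ}`. -/
def sphHarmonic (n : ℕ) (m : ℤ) (θ φ : ℝ) : ℂ :=
  normLegendre n m (Real.cos θ : ℂ) * Complex.exp (Complex.I * m * φ)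

/-- The modified Bessel function `I_ν(x)` of the first kind. -/
def besselI (ν x : ℝ) : ℝ :=
  ∑' k : ℕ, (x / 2) ^ (2 * (k : ℝ) + ν) / (k.factorial * Real.Gamma (k + ν + 1))

/-- The modified spherical Bessel function of the first kind,
`i_n(x) = √(π / (2x)) I_{n+1/2}(x)`, given by its power series, which is valid at `x = 0` too. -/
def sphBesselI (n : ℕ) (x : ℝ) : ℝ :=
  Real.sqrt Real.pi / 2 *
    ∑' k : ℕ, (x / 2) ^ (n + 2 * k) / (k.factorial * Real.Gamma (n + k + 3 / 2))

theorem sphBesselI_eq (n : ℕ) {x : ℝ} (hx : 0 < x) :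
    sphBesselI n x = Real.sqrt (Real.pi / (2 * x)) * besselI (n + 1 / 2) x := by
  unfold sphBesselI besselI
  rw [← tsum_mul_left, ← tsum_mul_left]
  congr 1
  funext k
  have hx2 : 0 < x / 2 := by positivity
  have e : 2 * (k : ℝ) + ((n : ℝ) + 1 / 2) = ((n + 2 * k : ℕ) : ℝ) + 1 / 2 := by
    push_cast; ring
  have hs : Real.sqrt (Real.pi / (2 * x)) * Real.sqrt (x / 2) = Real.sqrt Real.pi / 2 := by
    rw [← Real.sqrt_mul (by positivity)]
    have : Real.pi / (2 * x) * (x / 2) = Real.pi / 2 ^ 2 := by field_simp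
    rw [this, Real.sqrt_div Real.pi_pos.le, Real.sqrt_sq (by norm_num)]
  have eG : (k : ℝ) + ((n : ℝ) + 1 / 2) + 1 = n + k + 3 / 2 := by ring
  rw [e, Real.rpow_add hx2, Real.rpow_natCast, ← Real.sqrt_eq_rpow, eG, ← hs]
  ring

/-- `(R, θ, φ)` are spherical coordinates of `r` (polar angle `θ`, azimuthal angle `φ`). -/
def IsSphericalCoords (r : EuclideanSpace ℝ (Fin 3)) (R θ φ : ℝ) : Prop :=
  0 ≤ R ∧ θ ∈ Set.Icc 0 Real.pi ∧
    r 0 = R * Real.sin θ * Real.cos φ ∧ r 1 = R * Real.sin θ * Real.sin φ ∧ r 2 = R * Real.cos θ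

/-- `B_n^m(r) = 4π (-1)^n i_n(λ r) Y_n^m(θ, φ)`, for `r` with spherical coordinates `(R, θ, φ)`. -/
def coeffB (lam : ℝ) (n : ℕ) (m : ℤ) (R θ φ : ℝ) : ℂ :=
  4 * Real.pi * (-1) ^ n * (sphBesselI n (lam * R) : ℂ) * sphHarmonic n m θ φ

/-- The complex vector `(iρ cos α, iρ sin α, -w)`. -/
def waveVector (α : ℝ) (ρ w : ℂ) : Fin 3 → ℂ :=
  ![Complex.I * ρ * Real.cos α, Complex.I * ρ * Real.sin α, -w]

/-- The bilinear product `v · r` of a complex and a real vector. -/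
def dot (v : Fin 3 → ℂ) (r : EuclideanSpace ℝ (Fin 3)) : ℂ :=
  ∑ j, v j * (r j : ℂ)

end

end FunkHecke

open FunkHecke

namespace FunkHecke

open Polynomial

/-! Put `w = λ_z/λ`, `s = -iλ_ρ/λ`, `c = cos θ`, `σ = sin θ`, `h = e^{±i(φ-α)}`. The exponent is
`-λR u` with `u = w c + s σ (h + h⁻¹)/2` (`dot_waveVector`), so the claim combines two expansions.
(a) `e^{xu} = ∑ (2n+1) i_n(x) P_n(u)` for every complex `u` (`hasSum_sphBesselI_mul_legendreP`):
Bonnet's recurrence expands `u^N/N!` in Legendre polynomials, and the resulting double series may be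
rearranged because it converges absolutely. (b) The addition theorem (`hasSum_additionCoeff`):
`P_n(u)` is a Laurent polynomial in `h` whose coefficients are products of associated Legendre
functions. Multiplication by `u` shifts powers of `h`, so Bonnet's recurrence reduces this to an
identity between coefficients. Only `s² = 1 - w²` and `σ² = 1 - c²` enter, so either sign of a root
is allowed and no analytic continuation is needed. The statement on the branch is the case `λ_ρ = i
√(λ² - λ_z²)`. -/

/-! ### Recurrences for Legendre polynomials and their derivatives. -/

theorem legendreP_zero : legendreP 0 = 1 := by
  simp [legendreP]

theorem legendreP_one : legendreP 1 = X := by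
  have h : (C (2 : ℂ)⁻¹) * C (2 : ℂ) = 1 := by rw [← C_mul]; norm_num
  simp [legendreP, ← mul_assoc, one_add_one_eq_two, h]

theorem iterate_derivative_eq_smul_legendreP (n : ℕ) :
    derivative^[n] ((X ^ 2 - 1 : ℂ[X]) ^ n) = C (2 ^ n * n.factorial : ℂ) * legendreP n := by
  have h : (2 ^ n * n.factorial : ℂ) ≠ 0 :=
    mul_ne_zero (by simp) (Nat.cast_ne_zero.2 (Nat.factorial_ne_zero _))
  rw [legendreP, ← mul_assoc, ← C_mul, mul_inv_cancel₀ h, C_1, one_mul]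

theorem legendreP_natDegree_le (n : ℕ) : (legendreP n).natDegree ≤ n := by
  refine (natDegree_C_mul_le _ _).trans ((natDegree_iterate_derivative _ _).trans ?_)
  have h : ((X ^ 2 - 1 : ℂ[X]) ^ n).natDegree ≤ n * 2 :=
    natDegree_pow_le_of_le n (by compute_degree)
  omega

theorem iterate_derivative_legendreP_eq_zero {n k : ℕ} (h : n < k) :
    derivative^[k] (legendreP n) = 0 :=
  iterate_derivative_eq_zero ((legendreP_natDegree_le n).trans_lt h)

/-- `P'_{n+1} = X P'_n + (n + 1) P_n`. -/
theorem derivative_legendreP_succ (n : ℕ) :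
    derivative (legendreP (n + 1)) =
      X * derivative (legendreP n) + (n + 1 : ℂ[X]) * legendreP n := by
  have h0 : (2 ^ (n + 1) * (n + 1).factorial : ℂ) ≠ 0 :=
    mul_ne_zero (by simp) (Nat.cast_ne_zero.2 (Nat.factorial_ne_zero _))
  have hd : derivative ((X ^ 2 - 1 : ℂ[X]) ^ (n + 1)) =
      C (2 * (n + 1) : ℂ) * ((X ^ 2 - 1) ^ n * X) := by
    rw [derivative_pow_succ]
    simp [C_ofNat]; ring
  have h1 : derivative (derivative^[n + 1] ((X ^ 2 - 1 : ℂ[X]) ^ (n + 1))) =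
      C (2 * (n + 1) : ℂ) * (derivative (derivative^[n] ((X ^ 2 - 1 : ℂ[X]) ^ n)) * X +
        (n + 1 : ℂ[X]) * derivative^[n] ((X ^ 2 - 1 : ℂ[X]) ^ n)) := by
    rw [Function.iterate_succ_apply, hd, ← Function.iterate_succ_apply' derivative n,
      iterate_derivative_C_mul, iterate_derivative_mul_X, ← Function.iterate_succ_apply' derivative]
    simp
  rw [iterate_derivative_eq_smul_legendreP, iterate_derivative_eq_smul_legendreP,
    derivative_C_mul, derivative_C_mul] at h1
  refine mul_left_cancel₀ (C_ne_zero.2 h0) (h1.trans ?_)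
  rw [Nat.factorial_succ]
  simp only [C_mul, C_pow, C_add, C_1, Nat.cast_mul, Nat.cast_add, Nat.cast_one, map_natCast]
  ring

/-- `P'_{n+2} = (2 n + 3) P_{n+1} + P'_n`. -/
theorem derivative_legendreP_add_two (n : ℕ) :
    derivative (legendreP (n + 2)) =
      (2 * n + 3 : ℂ[X]) * legendreP (n + 1) + derivative (legendreP n) := by
  have h0 : (2 ^ (n + 2) * (n + 2).factorial : ℂ) ≠ 0 :=
    mul_ne_zero (by simp) (Nat.cast_ne_zero.2 (Nat.factorial_ne_zero _))
  -- Writing `X² = (X² - 1) + 1` leaves only powers of `X² - 1`, to which Rodrigues' formula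
  -- applies.
  have hd : derivative (derivative ((X ^ 2 - 1 : ℂ[X]) ^ (n + 2))) =
      C (2 * (n + 2) * (2 * n + 3) : ℂ) * (X ^ 2 - 1) ^ (n + 1) +
        C (4 * (n + 1) * (n + 2) : ℂ) * (X ^ 2 - 1) ^ n := by
    simp only [derivative_pow_succ, derivative_mul, derivative_sub, derivative_one,
      derivative_X, C_mul, C_add, map_natCast, C_ofNat, C_1, Nat.cast_add, Nat.cast_one]
    simp
    ring
  have h1 : derivative (derivative^[n + 2] ((X ^ 2 - 1 : ℂ[X]) ^ (n + 2))) =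
      C (2 * (n + 2) * (2 * n + 3) : ℂ) * derivative^[n + 1] ((X ^ 2 - 1) ^ (n + 1)) +
        C (4 * (n + 1) * (n + 2) : ℂ) * derivative (derivative^[n] ((X ^ 2 - 1) ^ n)) := by
    rw [Function.iterate_succ_apply, Function.iterate_succ_apply, hd,
      ← Function.iterate_succ_apply' derivative n, ← Function.iterate_succ_apply' derivative n,
      iterate_map_add, iterate_derivative_C_mul, iterate_derivative_C_mul]
  rw [iterate_derivative_eq_smul_legendreP, iterate_derivative_eq_smul_legendreP,
    iterate_derivative_eq_smul_legendreP, derivative_C_mul, derivative_C_mul] at h1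
  refine mul_left_cancel₀ (C_ne_zero.2 h0) (h1.trans ?_)
  rw [Nat.factorial_succ (n + 1), Nat.factorial_succ n]
  simp only [C_mul, C_pow, C_add, C_1, Nat.cast_mul, Nat.cast_add, Nat.cast_one, map_natCast,
    C_ofNat]
  ring

/-- `X P'_{n+1} = (n + 1) P_{n+1} + P'_n`. -/
theorem X_mul_derivative_legendreP (n : ℕ) :
    X * derivative (legendreP (n + 1)) =
      (n + 1 : ℂ[X]) * legendreP (n + 1) + derivative (legendreP n) := by
  have h1 := derivative_legendreP_succ (n + 1)
  have h2 := derivative_legendreP_add_two n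
  push_cast at h1
  linear_combination h2 - h1

theorem X_sq_sub_one_mul_derivative_legendreP (n : ℕ) :
    (X ^ 2 - 1) * derivative (legendreP n) =
      (n + 1 : ℂ[X]) * (legendreP (n + 1) - X * legendreP n) := by
  linear_combination X_mul_derivative_legendreP n - X * derivative_legendreP_succ n

/-- Bonnet's recurrence. -/
theorem legendreP_bonnet (n : ℕ) :
    (2 * n + 3 : ℂ[X]) * (X * legendreP (n + 1)) =
      (n + 2 : ℂ[X]) * legendreP (n + 2) + (n + 1 : ℂ[X]) * legendreP n := by
  have h1 := X_sq_sub_one_mul_derivative_legendreP (n + 1)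
  have h2 := X_mul_derivative_legendreP n
  have h3 := derivative_legendreP_succ n
  push_cast at h1
  linear_combination h1 - X * h2 + h3

/-- The associated Legendre recurrences, in terms of iterated derivatives. -/
theorem iterate_derivative_legendreP_add_two (n k : ℕ) :
    (2 * n + 3 : ℂ[X]) * derivative^[k] (legendreP (n + 1)) =
      derivative^[k + 1] (legendreP (n + 2)) - derivative^[k + 1] (legendreP n) := by
  have h := congrArg derivative^[k] (derivative_legendreP_add_two n)
  have e : (2 * n + 3 : ℂ[X]) = C (2 * n + 3 : ℂ) := by simp [C_ofNat]
  rw [iterate_map_add, e, iterate_derivative_C_mul] at h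
  simp only [← Function.iterate_succ_apply, ← e] at h
  linear_combination -h

/-- Bonnet's recurrence differentiated `k` times; the term produced by differentiating the factor
`X` is absorbed by `iterate_derivative_legendreP_add_two`. The factor `n + 2 - k` is a genuine,
possibly negative, difference. -/
theorem X_mul_iterate_derivative_legendreP (n k : ℕ) :
    (2 * n + 3 : ℂ[X]) * (X * derivative^[k] (legendreP (n + 1))) =
      (n + 2 - k : ℂ[X]) * derivative^[k] (legendreP (n + 2)) +
        (n + 1 + k : ℂ[X]) * derivative^[k] (legendreP n) := by
  induction k with
  | zero => simpa using legendreP_bonnet n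
  | succ k ih =>
    have h := congrArg derivative ih
    have e1 : (2 * n + 3 : ℂ[X]) = C (2 * n + 3 : ℂ) := by simp [C_ofNat]
    have e2 : (n + 2 - k : ℂ[X]) = C (n + 2 - k : ℂ) := by simp [C_ofNat]
    have e3 : (n + 1 + k : ℂ[X]) = C (n + 1 + k : ℂ) := by simp
    have h2 := iterate_derivative_legendreP_add_two n k
    rw [derivative_add, e1, e2, e3, derivative_C_mul, derivative_C_mul, derivative_C_mul,
      derivative_mul, derivative_X, ← e1, ← e2, ← e3] at h
    simp only [← Function.iterate_succ_apply' derivative] at h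
    push_cast
    linear_combination h - h2

/-- Again by differentiating in `k`: the term with `-2X` coming from `1 - X²` is removed by the
preceding recurrence at order `k + 1`. -/
theorem one_sub_X_sq_mul_iterate_derivative_legendreP (n k : ℕ) :
    (2 * n + 3 : ℂ[X]) * ((1 - X ^ 2) * derivative^[k + 1] (legendreP (n + 1))) =
      ((n + 1 + k) * (n + 2 + k) : ℂ[X]) * derivative^[k] (legendreP n) -
        ((n + 1 - k) * (n + 2 - k) : ℂ[X]) * derivative^[k] (legendreP (n + 2)) := by
  induction k with
  | zero =>
    have h1 := X_sq_sub_one_mul_derivative_legendreP (n + 1)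
    have h2 := legendreP_bonnet n
    push_cast at h1
    simp only [zero_add, Function.iterate_one, Function.iterate_zero, id, Nat.cast_zero]
    linear_combination -(2 * n + 3 : ℂ[X]) * h1 + (n + 2 : ℂ[X]) * h2
  | succ k ih =>
    have h := congrArg derivative ih
    have e1 : (2 * n + 3 : ℂ[X]) = C (2 * n + 3 : ℂ) := by simp [C_ofNat]
    have e2 : ((n + 1 - k) * (n + 2 - k) : ℂ[X]) = C ((n + 1 - k) * (n + 2 - k) : ℂ) := by
      simp [C_ofNat]
    have e3 : ((n + 1 + k) * (n + 2 + k) : ℂ[X]) = C ((n + 1 + k) * (n + 2 + k) : ℂ) := by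
      simp [C_ofNat]
    have h2 := X_mul_iterate_derivative_legendreP n (k + 1)
    rw [derivative_sub, e1, e2, e3, derivative_C_mul, derivative_C_mul, derivative_C_mul,
      derivative_mul, derivative_sub, derivative_one, derivative_X_pow, ← e1, ← e2, ← e3] at h
    simp only [← Function.iterate_succ_apply' derivative] at h
    push_cast at h h2 ⊢
    simp only [C_ofNat] at h
    linear_combination h + 2 * h2

/-! ### The addition theorem. -/

/-- The coefficient of `h ^ m` in the Laurent expansion of `P_n (w c + s σ (h + h⁻¹) / 2)`, where
`s ^ 2 = 1 - w ^ 2` and `σ ^ 2 = 1 - c ^ 2`. -/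
noncomputable def additionCoeff (n : ℕ) (s w σ c : ℂ) (m : ℤ) : ℂ :=
  ((n - m.natAbs).factorial / (n + m.natAbs).factorial : ℂ) * ((s * σ) ^ m.natAbs *
    ((derivative^[m.natAbs] (legendreP n)).eval w * (derivative^[m.natAbs] (legendreP n)).eval c))

theorem additionCoeff_neg (n : ℕ) (s w σ c : ℂ) (m : ℤ) :
    additionCoeff n s w σ c (-m) = additionCoeff n s w σ c m := by
  simp [additionCoeff]

/-- Makes the Laurent expansion finite, and the truncated subtraction in `additionCoeff` harmless.
-/
theorem additionCoeff_eq_zero {n : ℕ} {m : ℤ} (h : n < m.natAbs) (s w σ c : ℂ) :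
    additionCoeff n s w σ c m = 0 := by
  simp [additionCoeff, iterate_derivative_legendreP_eq_zero h]

theorem eval_iterate_derivative_legendreP_relations (n k : ℕ) {s w : ℂ} (hs : s ^ 2 = 1 - w ^ 2) :
    (2 * n + 3) * (derivative^[k] (legendreP (n + 1))).eval w =
        (derivative^[k + 1] (legendreP (n + 2))).eval w -
          (derivative^[k + 1] (legendreP n)).eval w ∧
      (2 * n + 3) * (w * (derivative^[k] (legendreP (n + 1))).eval w) =
        (n + 2 - k) * (derivative^[k] (legendreP (n + 2))).eval w +
          (n + 1 + k) * (derivative^[k] (legendreP n)).eval w ∧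
      (2 * n + 3) * (s ^ 2 * (derivative^[k + 1] (legendreP (n + 1))).eval w) =
        (n + 1 + k) * (n + 2 + k) * (derivative^[k] (legendreP n)).eval w -
          (n + 1 - k) * (n + 2 - k) * (derivative^[k] (legendreP (n + 2))).eval w := by
  have h1 := congrArg (eval w) (iterate_derivative_legendreP_add_two n k)
  have h2 := congrArg (eval w) (X_mul_iterate_derivative_legendreP n k)
  have h3 := congrArg (eval w) (one_sub_X_sq_mul_iterate_derivative_legendreP n k)
  simp only [eval_mul, eval_add, eval_sub, eval_pow, eval_X, eval_one, eval_natCast,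
    eval_ofNat] at h1 h2 h3
  exact ⟨h1, h2, by rw [hs]; exact h3⟩

/-- The indices `1` and `-1` contribute equally, hence `s σ` in place of `s σ / 2`. -/
theorem additionCoeff_zero_recurrence (n : ℕ) {s w σ c : ℂ} (hs : s ^ 2 = 1 - w ^ 2)
    (hσ : σ ^ 2 = 1 - c ^ 2) :
    (n + 2) * additionCoeff (n + 2) s w σ c 0 =
      (2 * n + 3) * (w * c * additionCoeff (n + 1) s w σ c 0 +
        s * σ * additionCoeff (n + 1) s w σ c 1) - (n + 1) * additionCoeff n s w σ c 0 := by
  obtain ⟨-, w1, w2⟩ := eval_iterate_derivative_legendreP_relations n 0 hs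
  obtain ⟨-, c1, c2⟩ := eval_iterate_derivative_legendreP_relations n 0 hσ
  have h1 : (n + 1 : ℂ) ≠ 0 := by exact_mod_cast Nat.succ_ne_zero n
  have h2 : (n + 2 : ℂ) ≠ 0 := by exact_mod_cast Nat.succ_ne_zero (n + 1)
  have h3 : (2 * n + 3 : ℂ) ≠ 0 := by exact_mod_cast Nat.succ_ne_zero (2 * n + 2)
  have g0 (j : ℕ) : (j.factorial / j.factorial : ℂ) = 1 :=
    div_self (Nat.cast_ne_zero.2 (Nat.factorial_ne_zero _))
  have g1 : (n.factorial / (n + 2).factorial : ℂ) = 1 / ((n + 1) * (n + 2)) := by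
    rw [Nat.factorial_succ, Nat.factorial_succ]; push_cast; rw [add_assoc, one_add_one_eq_two]
    field_simp
    exact g0 n
  simp only [additionCoeff, Int.natAbs_zero, Int.natAbs_one, Nat.sub_zero, add_zero,
    Nat.add_sub_cancel, g0, g1, pow_zero, pow_one, one_mul, add_assoc, one_add_one_eq_two]
  simp only [Nat.cast_zero, add_zero, sub_zero, zero_add] at w1 w2 c1 c2
  generalize (derivative^[1] (legendreP (n + 1))).eval w = W1 at *
  generalize (derivative^[1] (legendreP (n + 1))).eval c = C1 at *
  generalize (derivative^[0] (legendreP (n + 1))).eval w = W0 at *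
  generalize (derivative^[0] (legendreP (n + 1))).eval c = C0 at *
  generalize (derivative^[0] (legendreP (n + 2))).eval w = Wu at *
  generalize (derivative^[0] (legendreP (n + 2))).eval c = Cu at *
  generalize (derivative^[0] (legendreP n)).eval w = Wd at *
  generalize (derivative^[0] (legendreP n)).eval c = Cd at *
  -- Multiplying each relation at `w` by its counterpart at `c` produces the products in the
  -- coefficients; the mixed terms `Wu * Cd` and `Wd * Cu` cancel between `e1` and `e2`.
  have e1 := congrArg₂ (· * ·) w1 c1
  have e2 := congrArg₂ (· * ·) w2 c2
  obtain ⟨F, hF⟩ : ∃ F : ℂ, F = 1 / ((n + 1) * (n + 2)) := ⟨_, rfl⟩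
  have hF' : F * (n + 1) * (n + 2) = 1 := by rw [hF]; field_simp
  rw [← hF]
  refine mul_left_cancel₀ h3 ?_
  linear_combination -e1 - F * e2 - (n + 1) * (n + 2) * (Wd - Wu) * (Cd - Cu) * hF'

theorem additionCoeff_succ_recurrence (n k : ℕ) {s w σ c : ℂ} (hs : s ^ 2 = 1 - w ^ 2)
    (hσ : σ ^ 2 = 1 - c ^ 2) :
    (n + 2) * additionCoeff (n + 2) s w σ c (k + 1 : ℕ) =
      (2 * n + 3) * (w * c * additionCoeff (n + 1) s w σ c (k + 1 : ℕ) +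
        s * σ / 2 * (additionCoeff (n + 1) s w σ c k + additionCoeff (n + 1) s w σ c (k + 2 : ℕ))) -
          (n + 1) * additionCoeff n s w σ c (k + 1 : ℕ) := by
  obtain ⟨w0, -, -⟩ := eval_iterate_derivative_legendreP_relations n k hs
  obtain ⟨c0, -, -⟩ := eval_iterate_derivative_legendreP_relations n k hσ
  obtain ⟨-, w1, w2⟩ := eval_iterate_derivative_legendreP_relations n (k + 1) hs
  obtain ⟨-, c1, c2⟩ := eval_iterate_derivative_legendreP_relations n (k + 1) hσ
  have e0 := congrArg₂ (· * ·) w0 c0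
  have e1 := congrArg₂ (· * ·) w1 c1
  have e2 := congrArg₂ (· * ·) w2 c2
  have h3 : (2 * n + 3 : ℂ) ≠ 0 := by exact_mod_cast Nat.succ_ne_zero (2 * n + 2)
  have fs (j : ℕ) : ((j + 1).factorial : ℂ) = (j + 1) * j.factorial := by
    rw [Nat.factorial_succ]; push_cast; rfl
  have ne (j : ℕ) : (j.factorial : ℂ) ≠ 0 := Nat.cast_ne_zero.2 (Nat.factorial_ne_zero _)
  have ne' (j : ℕ) : (j + 1 : ℂ) ≠ 0 := by exact_mod_cast Nat.succ_ne_zero j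
  have z (i j : ℕ) (hk : i < j) (x : ℂ) : (derivative^[j] (legendreP i)).eval x = 0 := by
    rw [iterate_derivative_legendreP_eq_zero hk, eval_zero]
  refine mul_left_cancel₀ h3 ?_
  simp only [additionCoeff, Int.natAbs_natCast, pow_succ (s * σ)] at e0 e1 e2 ⊢
  -- For `k < n` all factorials are generic. From `k = n` on some derivatives vanish and the
  -- subtractions may truncate, so the boundary orders are treated separately.
  rcases lt_trichotomy k n with hk | rfl | hk
  · obtain ⟨j, rfl⟩ := Nat.exists_eq_add_of_lt hk
    have q1 := ne' (2 * k + j + 2)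
    have q2 := ne' (2 * k + j + 3)
    have neF := ne (2 * k + j + 2)
    -- With `n = k + j + 1`, every factorial ratio that occurs is a polynomial multiple of this `F`.
    obtain ⟨F, hF⟩ : ∃ F : ℂ, F = j.factorial / (2 * k + j + 4).factorial := ⟨_, rfl⟩
    have f0 : (j.factorial / (2 * k + j + 2).factorial : ℂ) =
        F * ((2 * k + j + 3) * (2 * k + j + 4)) := by
      rw [hF, fs (2 * k + j + 3), fs (2 * k + j + 2)]; push_cast at q1 q2 ⊢; field_simp; ring
    have f1 : ((j + 1).factorial / (2 * k + j + 3).factorial : ℂ) =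
        F * ((j + 1) * (2 * k + j + 4)) := by
      rw [hF, fs (2 * k + j + 3), fs j]; push_cast at q1 q2 ⊢; field_simp; ring
    have f2 : ((j + 2).factorial / (2 * k + j + 4).factorial : ℂ) =
        F * ((j + 1) * (j + 2)) := by
      rw [hF, fs (j + 1), fs j]; push_cast at q1 q2 ⊢; field_simp; ring
    have f3 : ((j + 2).factorial / (2 * k + j + 2).factorial : ℂ) =
        F * ((j + 1) * (j + 2) * (2 * k + j + 3) * (2 * k + j + 4)) := by
      rw [hF, fs (j + 1), fs j, fs (2 * k + j + 3), fs (2 * k + j + 2)]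
      push_cast at q1 q2 ⊢
      field_simp
      ring
    rw [show k + j + 1 + 2 - (k + 1) = j + 2 by omega,
      show k + j + 1 + 1 - (k + 1) = j + 1 by omega,
      show k + j + 1 + 1 - k = j + 2 by omega, show k + j + 1 + 1 - (k + 2) = j by omega,
      show k + j + 1 - (k + 1) = j by omega,
      show k + j + 1 + 2 + (k + 1) = 2 * k + j + 4 by omega,
      show k + j + 1 + 1 + (k + 1) = 2 * k + j + 3 by omega,
      show k + j + 1 + 1 + k = 2 * k + j + 2 by omega,
      show k + j + 1 + 1 + (k + 2) = 2 * k + j + 4 by omega,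
      show k + j + 1 + (k + 1) = 2 * k + j + 2 by omega, f0, f1, f2, f3, ← hF]
    push_cast at e0 e1 e2 ⊢
    linear_combination -F * (s * σ) ^ k * (s * σ) * ((j + 1) * (2 * k + j + 4) * e1 +
      (j + 1) * (j + 2) * (2 * k + j + 3) * (2 * k + j + 4) / 2 * e0 + e2 / 2)
  · have q1 := ne' (2 * k + 1)
    have q2 : (k * 2 + 3 : ℂ) ≠ 0 := by rwa [mul_comm]
    have neF := ne (2 * k + 1)
    obtain ⟨F, hF⟩ : ∃ F : ℂ, F = 1 / (2 * k + 3).factorial := ⟨_, rfl⟩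
    have f1 : (1 / (2 * k + 2).factorial : ℂ) = F * (2 * k + 3) := by
      rw [hF, fs (2 * k + 2)]; push_cast
      rw [show (2 * k + 2 + 1 : ℂ) = 2 * k + 3 by ring]
      field_simp
    have f2 : (1 / (2 * k + 1).factorial : ℂ) = F * ((2 * k + 2) * (2 * k + 3)) := by
      rw [show F * ((2 * k + 2) * (2 * k + 3)) = F * (2 * k + 3) * (2 * k + 2) by ring, ← f1,
        fs (2 * k + 1)]
      push_cast at q1 ⊢
      field_simp
      ring
    rw [show k + 2 - (k + 1) = 1 by omega, show k + 1 - (k + 1) = 0 by omega,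
      show k + 1 - k = 1 by omega, show k + 2 + (k + 1) = 2 * k + 3 by omega,
      show k + 1 + (k + 1) = 2 * k + 2 by omega, show k + 1 + k = 2 * k + 1 by omega,
      Nat.factorial_one, Nat.factorial_zero, Nat.cast_one, f1, f2, ← hF]
    simp only [z k (k + 1) (by omega), z (k + 1) (k + 2) (by omega)] at e0 e1 e2 ⊢
    push_cast at e0 e1 e2 ⊢
    linear_combination -F * (s * σ) ^ k * (s * σ) * ((2 * k + 3) * e1 +
      (2 * k + 2) * (2 * k + 3) / 2 * e0)
  · simp only [z n (k + 1) (by omega), z (n + 1) (k + 1) (by omega),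
      z (n + 1) (k + 2) (by omega)] at e0 e1 e2 ⊢
    rcases (show n + 1 ≤ k from hk).eq_or_lt with rfl | hk
    · have q2 : (n * 2 + 3 : ℂ) ≠ 0 := by rwa [mul_comm]
      have q1 : (n + 2 : ℂ) ≠ 0 := by exact_mod_cast Nat.succ_ne_zero (n + 1)
      have neF := ne (2 * n + 2)
      have f : (n + 2) * (2 * n + 3) * (1 / (2 * n + 4).factorial : ℂ) =
          1 / (2 * n + 2).factorial / 2 := by
        rw [fs (2 * n + 3), fs (2 * n + 2)]; push_cast
        rw [show (2 * n + 3 + 1 : ℂ) = 2 * (n + 2) by ring,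
          show (2 * n + 2 + 1 : ℂ) = 2 * n + 3 by ring]
        field_simp
      rw [show n + 2 - (n + 1 + 1) = 0 by omega, show n + 1 - (n + 1) = 0 by omega,
        show n + 2 + (n + 1 + 1) = 2 * n + 4 by omega,
        show n + 1 + (n + 1) = 2 * n + 2 by omega, Nat.factorial_zero, Nat.cast_one]
      simp only [pow_succ (s * σ)]
      linear_combination (s * σ) ^ n * (s * σ) * (s * σ) *
        (eval w (derivative^[n + 1 + 1] (legendreP (n + 2))) *
          eval c (derivative^[n + 1 + 1] (legendreP (n + 2))) * f -
            1 / (2 * n + 2).factorial / 2 * e0)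
    · simp only [z (n + 1) k (by omega), z (n + 2) (k + 1) (by omega)]
      ring

theorem additionCoeff_recurrence (n : ℕ) (m : ℤ) {s w σ c : ℂ} (hs : s ^ 2 = 1 - w ^ 2)
    (hσ : σ ^ 2 = 1 - c ^ 2) :
    (n + 2) * additionCoeff (n + 2) s w σ c m =
      (2 * n + 3) * (w * c * additionCoeff (n + 1) s w σ c m +
        s * σ / 2 * (additionCoeff (n + 1) s w σ c (m - 1) +
          additionCoeff (n + 1) s w σ c (m + 1))) - (n + 1) * additionCoeff n s w σ c m := by
  rcases Int.eq_nat_or_neg m with ⟨k, rfl | rfl⟩ <;> rcases k with _ | k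
  · have h := additionCoeff_zero_recurrence n hs hσ
    have h' := additionCoeff_neg (n + 1) s w σ c 1
    simp only [Nat.cast_zero, zero_sub, zero_add, h']
    linear_combination h
  · have h := additionCoeff_succ_recurrence n k hs hσ
    push_cast at h ⊢
    rw [add_sub_cancel_right, add_assoc (k : ℤ), one_add_one_eq_two]
    exact h
  · have h := additionCoeff_zero_recurrence n hs hσ
    have h' := additionCoeff_neg (n + 1) s w σ c 1
    simp only [Nat.cast_zero, neg_zero, zero_sub, zero_add, h']
    linear_combination h
  · have h := additionCoeff_succ_recurrence n k hs hσ
    rw [show -((k + 1 : ℕ) : ℤ) - 1 = -((k + 2 : ℕ) : ℤ) by push_cast; ring,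
      show -((k + 1 : ℕ) : ℤ) + 1 = -(k : ℤ) by push_cast; ring]
    simp only [additionCoeff_neg]
    linear_combination h

/-- The addition theorem for the Legendre polynomials. -/
theorem hasSum_additionCoeff (n : ℕ) {s w σ c h : ℂ} (hs : s ^ 2 = 1 - w ^ 2)
    (hσ : σ ^ 2 = 1 - c ^ 2) (h0 : h ≠ 0) :
    HasSum (fun m : ℤ => additionCoeff n s w σ c m * h ^ m)
      ((legendreP n).eval (w * c + s * σ / 2 * (h + h⁻¹))) := by
  induction n using Nat.twoStepInduction with
  | zero =>
    have h1 := hasSum_single (f := fun m : ℤ => additionCoeff 0 s w σ c m * h ^ m) 0 (by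
      intro m hm
      rw [additionCoeff_eq_zero (by simpa [Int.natAbs_pos] using hm), zero_mul])
    simpa [additionCoeff, legendreP_zero] using h1
  | one =>
    have h1 := hasSum_sum_of_ne_finset_zero (f := fun m : ℤ => additionCoeff 1 s w σ c m * h ^ m)
      (s := {0, 1, -1}) (L := SummationFilter.unconditional ℤ) (by
        intro m hm
        have : 1 < m.natAbs := by simp at hm; omega
        rw [additionCoeff_eq_zero this, zero_mul])
    convert h1 using 1
    simp [additionCoeff, legendreP_one]
    ring
  | more n ih0 ih1 =>
    set u := w * c + s * σ / 2 * (h + h⁻¹) with hu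
    have h2 : (n + 2 : ℂ) ≠ 0 := by exact_mod_cast Nat.succ_ne_zero (n + 1)
    have hb := congrArg (eval u) (legendreP_bonnet n)
    simp only [eval_mul, eval_add, eval_X, eval_natCast, eval_ofNat, eval_one] at hb
    -- Multiplying the series by `h` or `h⁻¹` shifts its index, which turns Bonnet's recurrence at
    -- `u` into `additionCoeff_recurrence`.
    have hup : HasSum (fun m : ℤ => additionCoeff (n + 1) s w σ c (m - 1) * h ^ m)
        (h * (legendreP (n + 1)).eval u) := by
      refine HasSum.congr_fun ((Equiv.subRight (1 : ℤ)).hasSum_iff.2 (ih1.mul_left h)) fun m => ?_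
      simp only [Function.comp, Equiv.subRight_apply, zpow_sub₀ h0, zpow_one]
      field_simp
    have hdn : HasSum (fun m : ℤ => additionCoeff (n + 1) s w σ c (m + 1) * h ^ m)
        (h⁻¹ * (legendreP (n + 1)).eval u) := by
      refine HasSum.congr_fun ((Equiv.addRight (1 : ℤ)).hasSum_iff.2 (ih1.mul_left h⁻¹)) fun m => ?_
      simp only [Function.comp, Equiv.coe_addRight, zpow_add₀ h0, zpow_one]
      field_simp
    have := (((ih1.mul_left ((2 * n + 3) * (w * c))).add
      ((hup.add hdn).mul_left ((2 * n + 3) * (s * σ / 2)))).sub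
        (ih0.mul_left (n + 1 : ℂ))).mul_left (n + 2 : ℂ)⁻¹
    have hv : (legendreP (n + 2)).eval u = (n + 2 : ℂ)⁻¹ *
        ((2 * n + 3) * (w * c) * (legendreP (n + 1)).eval u +
          (2 * n + 3) * (s * σ / 2) * (h * (legendreP (n + 1)).eval u +
            h⁻¹ * (legendreP (n + 1)).eval u) - (n + 1) * (legendreP n).eval u) := by
      rw [eq_inv_mul_iff_mul_eq₀ h2]
      linear_combination -hb + (2 * n + 3) * (legendreP (n + 1)).eval u * hu
    rw [hv]
    refine HasSum.congr_fun this fun m => ?_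
    rw [eq_inv_mul_iff_mul_eq₀ h2]
    linear_combination h ^ m * additionCoeff_recurrence n m hs hσ

/-! ### Bonnet's recurrence at a point and the growth of Legendre polynomials. -/

theorem eval_legendreP_bonnet (n : ℕ) (u : ℂ) :
    (2 * n + 1) * (u * (legendreP n).eval u) =
      (n + 1) * (legendreP (n + 1)).eval u + n * (legendreP (n - 1)).eval u := by
  -- At `n = 0` the truncated index `n - 1` carries the factor `0`.
  rcases n with _ | n
  · simp [legendreP_zero, legendreP_one]
  · have h := congrArg (eval u) (legendreP_bonnet n)
    simp only [eval_mul, eval_add, eval_X, eval_natCast, eval_ofNat, eval_one] at h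
    push_cast
    linear_combination h

/-- Geometric growth is enough, since the Bessel coefficients decay factorially. The base works
because `2‖u‖B + 1 ≤ B²` and Bonnet's ratios are at most `2` and `1`. -/
theorem norm_eval_legendreP_le (n : ℕ) (u : ℂ) :
    ‖(legendreP n).eval u‖ ≤ (2 * ‖u‖ + 1) ^ n := by
  set B := 2 * ‖u‖ + 1 with hB
  have hB0 : 0 ≤ B := by positivity
  induction n using Nat.twoStepInduction with
  | zero => simp [legendreP_zero]
  | one => simp only [legendreP_one, eval_X, pow_one]; linarith [norm_nonneg u]
  | more n ih0 ih1 =>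
    have h := congrArg (eval u) (legendreP_bonnet n)
    simp only [eval_mul, eval_add, eval_X, eval_natCast, eval_ofNat, eval_one] at h
    have h1 : (n + 2 : ℂ) * (legendreP (n + 2)).eval u =
        (2 * n + 3) * (u * (legendreP (n + 1)).eval u) - (n + 1) * (legendreP n).eval u := by
      linear_combination -h
    have h2 := congrArg norm h1
    have n2 : ‖(n + 2 : ℂ)‖ = n + 2 := by simpa using Complex.norm_natCast (n + 2)
    have n3 : ‖(2 * n + 3 : ℂ)‖ = 2 * n + 3 := by simpa using Complex.norm_natCast (2 * n + 3)
    have n1 : ‖(n + 1 : ℂ)‖ = n + 1 := by simpa using Complex.norm_natCast (n + 1)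
    have h3 := norm_sub_le ((2 * n + 3) * (u * (legendreP (n + 1)).eval u))
      ((n + 1) * (legendreP n).eval u)
    rw [← h2] at h3
    simp only [norm_mul, n1, n2, n3] at h3
    have hp : 0 ≤ B ^ n := by positivity
    have h4 : (2 * n + 3) * (‖u‖ * ‖(legendreP (n + 1)).eval u‖) ≤
        (2 * n + 3) * (‖u‖ * B ^ (n + 1)) := by gcongr
    have h5 : (n + 1) * ‖(legendreP n).eval u‖ ≤ (n + 1) * B ^ n := by gcongr
    have h6 : (2 * n + 3) * (‖u‖ * B ^ (n + 1)) + (n + 1) * B ^ n ≤ (n + 2) * B ^ (n + 2) := by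
      have hu := norm_nonneg u
      have e : (n + 2) * B ^ (n + 2) - ((2 * n + 3) * (‖u‖ * B ^ (n + 1)) + (n + 1) * B ^ n) =
          B ^ n * (‖u‖ * (2 * ‖u‖ + 1) + (2 * n + 4) * ‖u‖ + 1) := by
        rw [pow_add, pow_add, hB]; ring
      have : 0 ≤ B ^ n * (‖u‖ * (2 * ‖u‖ + 1) + (2 * n + 4) * ‖u‖ + 1) := by positivity
      linarith
    exact le_of_mul_le_mul_left (h3.trans ((add_le_add h4 h5).trans h6)) (by positivity)

/-! ### Power series coefficients of the modified spherical Bessel functions. -/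

/-- The coefficient of `x ^ (n + 2 * k)` in the power series of the modified spherical Bessel
function `i_n`. -/
noncomputable def sphBesselCoeff (n k : ℕ) : ℝ :=
  Real.sqrt Real.pi / 2 / (2 ^ (n + 2 * k) * (k.factorial * Real.Gamma (n + k + 3 / 2)))

theorem gamma_add_three_halves_pos (n k : ℕ) : 0 < Real.Gamma (n + k + 3 / 2) :=
  Real.Gamma_pos_of_pos (by positivity)

theorem gamma_three_halves : Real.Gamma (3 / 2) = Real.sqrt Real.pi / 2 := by
  rw [show (3 / 2 : ℝ) = 1 / 2 + 1 by norm_num, Real.Gamma_add_one (by norm_num),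
    Real.Gamma_one_half_eq]
  ring

theorem sqrt_pi_mul_factorial_le_gamma (m : ℕ) :
    Real.sqrt Real.pi / 2 * m.factorial ≤ Real.Gamma (m + 3 / 2) := by
  induction m with
  | zero => simp [gamma_three_halves]
  | succ m ih =>
    rw [show ((m + 1 : ℕ) : ℝ) + 3 / 2 = (m + 3 / 2) + 1 by push_cast; ring,
      Real.Gamma_add_one (by positivity), Nat.factorial_succ]
    push_cast
    have h : 0 < Real.Gamma (m + 3 / 2) := Real.Gamma_pos_of_pos (by positivity)
    calc Real.sqrt Real.pi / 2 * ((m + 1) * m.factorial)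
        = (m + 1) * (Real.sqrt Real.pi / 2 * m.factorial) := by ring
      _ ≤ (m + 1) * Real.Gamma (m + 3 / 2) := by gcongr
      _ ≤ (m + 3 / 2) * Real.Gamma (m + 3 / 2) := by gcongr; norm_num

theorem sphBesselCoeff_nonneg (n k : ℕ) : 0 ≤ sphBesselCoeff n k := by
  have := gamma_add_three_halves_pos n k
  unfold sphBesselCoeff; positivity

/-- The bound separates `n` from `k`, so a product of two exponential series dominates the double
series. -/
theorem sphBesselCoeff_le (n k : ℕ) :
    sphBesselCoeff n k ≤ 1 / (n.factorial * k.factorial) := by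
  have hG := gamma_add_three_halves_pos n k
  have h1 := sqrt_pi_mul_factorial_le_gamma (n + k)
  have h2 : (n.factorial : ℝ) ≤ (n + k).factorial := by
    exact_mod_cast Nat.factorial_le (Nat.le_add_right n k)
  have h3 : (1 : ℝ) ≤ 2 ^ (n + 2 * k) := one_le_pow₀ (by norm_num)
  push_cast at h1
  unfold sphBesselCoeff
  rw [div_le_div_iff₀ (by positivity) (by positivity), one_mul]
  calc Real.sqrt Real.pi / 2 * (n.factorial * k.factorial)
      = 1 * (k.factorial * (Real.sqrt Real.pi / 2 * n.factorial)) := by ring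
    _ ≤ 2 ^ (n + 2 * k) * (k.factorial * Real.Gamma (n + k + 3 / 2)) := by
      gcongr
      exact le_trans (by gcongr) h1

theorem sphBesselCoeff_zero_zero : sphBesselCoeff 0 0 = 1 := by
  have := gamma_three_halves
  have h := (Real.sqrt_pos.2 Real.pi_pos).ne'
  simp [sphBesselCoeff, this, h]

/-- The relation `i_0' = i_1`, coefficient by coefficient. -/
theorem sphBesselCoeff_zero_succ (k : ℕ) :
    (2 * k + 2) * sphBesselCoeff 0 (k + 1) = sphBesselCoeff 1 k := by
  have hG := gamma_add_three_halves_pos 1 k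
  unfold sphBesselCoeff
  rw [show ((0 : ℕ) : ℝ) + (k + 1 : ℕ) + 3 / 2 = (1 : ℕ) + k + 3 / 2 by push_cast; ring,
    Nat.factorial_succ]
  push_cast at hG ⊢
  field_simp
  ring

theorem sphBesselCoeff_succ_zero (n : ℕ) :
    (2 * n + 3) * sphBesselCoeff (n + 1) 0 = sphBesselCoeff n 0 := by
  have hG := gamma_add_three_halves_pos n 0
  unfold sphBesselCoeff
  rw [show ((n + 1 : ℕ) : ℝ) + (0 : ℕ) + 3 / 2 = (n + (0 : ℕ) + 3 / 2) + 1 by push_cast; ring,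
    Real.Gamma_add_one (by positivity)]
  push_cast at hG ⊢
  field_simp
  ring

/-- The coefficients of `(2n+3) i_{n+1}' = (n+1) i_n + (n+2) i_{n+2}`; `sphBesselCoeff_succ_zero` is
its lowest order. -/
theorem sphBesselCoeff_succ_succ (n k : ℕ) :
    (n + 2 * k + 3) * (2 * n + 3) * sphBesselCoeff (n + 1) (k + 1) =
      (n + 1) * sphBesselCoeff n (k + 1) + (n + 2) * sphBesselCoeff (n + 2) k := by
  have hG := gamma_add_three_halves_pos n (k + 1)
  unfold sphBesselCoeff
  rw [show ((n + 1 : ℕ) : ℝ) + (k + 1 : ℕ) + 3 / 2 = (n + (k + 1 : ℕ) + 3 / 2) + 1 by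
      push_cast; ring,
    show ((n + 2 : ℕ) : ℝ) + k + 3 / 2 = (n + (k + 1 : ℕ) + 3 / 2) + 1 by push_cast; ring,
    Real.Gamma_add_one (by positivity), Nat.factorial_succ]
  push_cast at hG ⊢
  field_simp
  ring

/-! ### Expansion of powers and of the exponential in Legendre polynomials. -/

/-- The coefficients of the expansion `u ^ N / N! = ∑ (2 n + 1) e(N, n) P_n(u)`. -/
noncomputable def powLegendreCoeff (N n : ℕ) : ℝ :=
  if n ≤ N ∧ Even (N - n) then sphBesselCoeff n ((N - n) / 2) else 0

theorem powLegendreCoeff_add (n k : ℕ) :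
    powLegendreCoeff (n + 2 * k) n = sphBesselCoeff n k := by
  simp [powLegendreCoeff]

theorem powLegendreCoeff_eq_zero {N n : ℕ} (h : ∀ k, N ≠ n + 2 * k) :
    powLegendreCoeff N n = 0 := by
  refine if_neg fun ⟨h1, k, hk⟩ => h k (by omega)

theorem powLegendreCoeff_recurrence_zero (N : ℕ) :
    (N + 1) * powLegendreCoeff (N + 1) 0 = powLegendreCoeff N 1 := by
  by_cases h : ∃ k, N = 1 + 2 * k
  · obtain ⟨k, rfl⟩ := h
    rw [powLegendreCoeff_add, show 1 + 2 * k + 1 = 0 + 2 * (k + 1) by ring, powLegendreCoeff_add,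
      ← sphBesselCoeff_zero_succ]
    push_cast; ring
  · push Not at h
    rw [powLegendreCoeff_eq_zero h, powLegendreCoeff_eq_zero, mul_zero]
    intro k hk
    exact h (k - 1) (by omega)

theorem powLegendreCoeff_recurrence_succ (N n : ℕ) :
    (N + 1) * (2 * n + 3) * powLegendreCoeff (N + 1) (n + 1) =
      (n + 1) * powLegendreCoeff N n + (n + 2) * powLegendreCoeff N (n + 2) := by
  by_cases h : ∃ k, N = n + 2 * k
  · obtain ⟨k, rfl⟩ := h
    rw [show n + 2 * k + 1 = n + 1 + 2 * k by ring, powLegendreCoeff_add, powLegendreCoeff_add]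
    rcases k with _ | k
    · rw [powLegendreCoeff_eq_zero (fun k => by omega), ← sphBesselCoeff_succ_zero n]
      push_cast; ring
    · rw [show n + 2 * (k + 1) = n + 2 + 2 * k by ring, powLegendreCoeff_add,
        ← sphBesselCoeff_succ_succ]
      push_cast; ring
  · push Not at h
    rw [powLegendreCoeff_eq_zero h, powLegendreCoeff_eq_zero, powLegendreCoeff_eq_zero]
    · ring
    · intro k hk
      exact h (k + 1) (by omega)
    · intro k hk
      exact h k (by omega)

theorem sum_powLegendreCoeff_mul_legendreP (N : ℕ) (u : ℂ) :
    ∑ n ∈ Finset.range (N + 1),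
      (2 * n + 1) * (powLegendreCoeff N n : ℂ) * (legendreP n).eval u = u ^ N / N.factorial := by
  induction N with
  | zero => simp [powLegendreCoeff, sphBesselCoeff_zero_zero, legendreP_zero]
  | succ N ih =>
    have hN : (N + 1 : ℂ) ≠ 0 := by exact_mod_cast Nat.succ_ne_zero N
    -- Bonnet's recurrence sends degree `n` to `n + 1` and `n - 1`. The second range is lengthened
    -- by two zero coefficients so that all sums run over `N + 1` terms after reindexing.
    have h1 : u * (u ^ N / N.factorial) =
        ∑ n ∈ Finset.range (N + 1), (powLegendreCoeff N n : ℂ) *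
          ((n + 1) * (legendreP (n + 1)).eval u) +
        ∑ n ∈ Finset.range (N + 1 + 1 + 1), (powLegendreCoeff N n : ℂ) *
          (n * (legendreP (n - 1)).eval u) := by
      rw [Finset.sum_range_succ _ (N + 1 + 1), Finset.sum_range_succ _ (N + 1),
        powLegendreCoeff_eq_zero (n := N + 1 + 1) (fun k => by omega),
        powLegendreCoeff_eq_zero (n := N + 1) (fun k => by omega), ← ih, Finset.mul_sum]
      simp only [Complex.ofReal_zero, zero_mul, add_zero]
      rw [← Finset.sum_add_distrib]
      refine Finset.sum_congr rfl fun n _ => ?_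
      linear_combination (powLegendreCoeff N n : ℂ) * eval_legendreP_bonnet n u
    have h2 : u ^ (N + 1) / (N + 1).factorial = (N + 1 : ℂ)⁻¹ * (u * (u ^ N / N.factorial)) := by
      rw [Nat.factorial_succ, pow_succ]
      push_cast
      field_simp
    rw [h2, eq_inv_mul_iff_mul_eq₀ hN, h1, Finset.sum_range_succ' _ (N + 1),
      Finset.sum_range_succ' _ (N + 1 + 1), Finset.sum_range_succ' _ (N + 1), mul_add,
      Finset.mul_sum, ← add_assoc, ← add_assoc, ← Finset.sum_add_distrib]
    have r0 := congrArg (fun x : ℝ => (x : ℂ)) (powLegendreCoeff_recurrence_zero N)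
    push_cast at r0
    simp only [Nat.cast_zero, zero_mul, mul_zero, add_zero]
    congr 1
    · refine Finset.sum_congr rfl fun n _ => ?_
      have r := congrArg (fun x : ℝ => (x : ℂ)) (powLegendreCoeff_recurrence_succ N n)
      push_cast at r ⊢
      linear_combination (legendreP (n + 1)).eval u * r
    · push_cast
      simp only [zero_add]
      linear_combination (legendreP 0).eval u * r0

theorem hasSum_sphBesselI (n : ℕ) (x : ℝ) :
    HasSum (fun k : ℕ => sphBesselCoeff n k * x ^ (n + 2 * k)) (sphBesselI n x) := by
  have hs : Summable (fun k : ℕ => sphBesselCoeff n k * x ^ (n + 2 * k)) := by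
    refine .of_norm_bounded ((Real.summable_pow_div_factorial (x ^ 2)).mul_left (|x| ^ n))
      fun k => ?_
    have h1 : sphBesselCoeff n k ≤ 1 / k.factorial := by
      refine (sphBesselCoeff_le n k).trans ?_
      gcongr
      exact le_mul_of_one_le_left (by positivity) (by exact_mod_cast Nat.factorial_pos n)
    rw [norm_mul, Real.norm_of_nonneg (sphBesselCoeff_nonneg n k), norm_pow, Real.norm_eq_abs,
      pow_add, pow_mul, sq_abs]
    calc sphBesselCoeff n k * (|x| ^ n * (x ^ 2) ^ k)
        ≤ 1 / k.factorial * (|x| ^ n * (x ^ 2) ^ k) := by gcongr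
      _ = |x| ^ n * ((x ^ 2) ^ k / k.factorial) := by ring
  convert hs.hasSum using 1
  rw [sphBesselI, ← tsum_mul_left]
  refine tsum_congr fun k => ?_
  rw [sphBesselCoeff, div_pow]
  field_simp

theorem summable_sphBesselCoeff_mul_legendreP (x : ℝ) (u : ℂ) :
    Summable (fun p : ℕ × ℕ => (2 * p.1 + 1) * (sphBesselCoeff p.1 p.2 : ℂ) *
      (x : ℂ) ^ (p.1 + 2 * p.2) * (legendreP p.1).eval u) := by
  set B := 2 * ‖u‖ + 1
  have hB : 0 ≤ B := by positivity
  refine .of_norm_bounded ((Real.summable_pow_div_factorial (3 * (|x| * B))).mul_of_nonneg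
    (Real.summable_pow_div_factorial (x ^ 2)) (fun _ => by positivity) (fun _ => by positivity))
    fun ⟨n, k⟩ => ?_
  -- Bernoulli's inequality lets the factor `2n + 1` join the geometric part.
  have h1 : ‖(2 * n + 1 : ℂ)‖ ≤ 3 ^ n := by
    have e : ‖(2 * n + 1 : ℂ)‖ = 1 + n * 2 := by
      have := Complex.norm_natCast (2 * n + 1)
      push_cast at this
      rw [this]; ring
    rw [e]
    exact (one_add_mul_le_pow (by norm_num) n).trans_eq (by norm_num)
  simp only [norm_mul, norm_pow, Complex.norm_real, Real.norm_eq_abs,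
    abs_of_nonneg (sphBesselCoeff_nonneg n k)]
  calc ‖(2 * n + 1 : ℂ)‖ * sphBesselCoeff n k * |x| ^ (n + 2 * k) * ‖(legendreP n).eval u‖
      ≤ 3 ^ n * (1 / (n.factorial * k.factorial)) * |x| ^ (n + 2 * k) * B ^ n := by
        gcongr
        · exact sphBesselCoeff_nonneg n k
        · exact sphBesselCoeff_le n k
        · exact norm_eval_legendreP_le n u
    _ = (3 * (|x| * B)) ^ n / n.factorial * ((x ^ 2) ^ k / k.factorial) := by
        rw [pow_add, pow_mul, sq_abs, mul_pow, mul_pow]; ring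

/-- The expansion of the exponential function in Legendre polynomials. -/
theorem hasSum_sphBesselI_mul_legendreP (x : ℝ) (u : ℂ) :
    HasSum (fun n : ℕ => (2 * n + 1) * (sphBesselI n x : ℂ) * (legendreP n).eval u)
      (Complex.exp (x * u)) := by
  obtain ⟨a, hG⟩ := summable_sphBesselCoeff_mul_legendreP x u
  -- Reindexing by the total power `N = n + 2k`: summing over `n` first gives the exponential
  -- series, summing over `k` first gives the `i_n`.
  have hinj : Function.Injective (fun p : ℕ × ℕ => (p.1 + 2 * p.2, p.1)) := by
    rintro ⟨a, b⟩ ⟨c, d⟩ h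
    simp only [Prod.mk.injEq] at h ⊢
    omega
  have hG' : HasSum (fun q : ℕ × ℕ => (2 * q.2 + 1) * (powLegendreCoeff q.1 q.2 : ℂ) *
      (x : ℂ) ^ q.1 * (legendreP q.2).eval u) a := by
    refine (hinj.hasSum_iff ?_).1 (hG.congr_fun fun p => ?_)
    · rintro ⟨N, n⟩ h
      rw [powLegendreCoeff_eq_zero fun k hk => h ⟨(n, k), Prod.ext hk.symm rfl⟩]
      simp
    · simp only [Function.comp, powLegendreCoeff_add]
  have h1 : HasSum (fun N : ℕ => (x * u) ^ N / (N.factorial : ℂ)) a := by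
    refine hG'.prod_fiberwise fun N => ?_
    have h2 := hasSum_sum_of_ne_finset_zero (L := SummationFilter.unconditional ℕ)
      (f := fun n : ℕ => (2 * n + 1) * (powLegendreCoeff N n : ℂ) *
        (x : ℂ) ^ N * (legendreP n).eval u) (s := Finset.range (N + 1)) (by
        intro n hn
        rw [powLegendreCoeff_eq_zero fun k hk => hn (by simp; omega)]
        simp)
    convert h2 using 1
    rw [mul_pow, mul_div_assoc, ← sum_powLegendreCoeff_mul_legendreP, Finset.mul_sum]
    exact Finset.sum_congr rfl fun n _ => by ring
  have h2 := h1.unique (NormedSpace.expSeries_div_hasSum_exp (x * u : ℂ))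
  rw [← Complex.exp_eq_exp_ℂ] at h2
  rw [h2] at hG
  refine hG.prod_fiberwise fun n => ?_
  have h3 := (((Complex.hasSum_ofReal.2 (hasSum_sphBesselI n x)).mul_left
    (2 * n + 1 : ℂ)).mul_right ((legendreP n).eval u))
  refine h3.congr_fun fun k => ?_
  push_cast
  ring

theorem sphBesselI_neg (n : ℕ) (x : ℝ) : sphBesselI n (-x) = (-1) ^ n * sphBesselI n x := by
  refine (hasSum_sphBesselI n (-x)).unique (((hasSum_sphBesselI n x).mul_left _).congr_fun
    fun k => ?_)
  rw [neg_pow, pow_add (-1 : ℝ) n, pow_mul]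
  simp
  ring

/-! ### The branch of the square root, and complex conjugation. -/

/-- Positive scaling preserves arguments. This ties the root in the exponent to the root in
`normLegendre`. -/
theorem branchSqrt_div {k : ℝ} (hk : 0 < k) (w : ℂ) :
    branchSqrt 1 (w / k) = branchSqrt k w / k := by
  have hk0 : (k : ℂ) ≠ 0 := Complex.ofReal_ne_zero.2 hk.ne'
  have e1 : w / k + (1 : ℝ) = (k⁻¹ : ℝ) * (w + k) := by push_cast; field_simp
  have e2 : w / k - (1 : ℝ) = (k⁻¹ : ℝ) * (w - k) := by push_cast; field_simp
  have hk' : 0 < k⁻¹ := inv_pos.2 hk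
  unfold branchSqrt
  rw [e1, e2, Complex.arg_real_mul _ hk', Complex.arg_real_mul _ hk', norm_mul, norm_mul,
    Complex.norm_real, Real.norm_of_nonneg hk'.le,
    show k⁻¹ * ‖w + k‖ * (k⁻¹ * ‖w - k‖) = k⁻¹ ^ 2 * (‖w + k‖ * ‖w - k‖) by ring,
    Real.sqrt_mul (by positivity), Real.sqrt_sq hk'.le]
  push_cast
  ring

theorem branchSqrt_one_cos {θ : ℝ} (hθ : θ ∈ Set.Icc 0 Real.pi) :
    branchSqrt 1 (Real.cos θ : ℂ) = (Real.sin θ : ℂ) := by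
  have hs : 0 ≤ Real.sin θ := Real.sin_nonneg_of_mem_Icc hθ
  have h1 : 0 ≤ Real.cos θ + 1 := by linarith [Real.neg_one_le_cos θ]
  have h2 : Real.cos θ - 1 ≤ 0 := by linarith [Real.cos_le_one θ]
  have hsq : Real.sqrt (‖(Real.cos θ : ℂ) + (1 : ℝ)‖ * ‖(Real.cos θ : ℂ) - (1 : ℝ)‖) =
      Real.sin θ := by
    rw [← Complex.ofReal_add, ← Complex.ofReal_sub, Complex.norm_real, Complex.norm_real,
      Real.norm_of_nonneg h1, Real.norm_of_nonpos h2,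
      show (Real.cos θ + 1) * -(Real.cos θ - 1) = Real.sin θ ^ 2 by
        rw [Real.sin_sq]; ring, Real.sqrt_sq hs]
  unfold branchSqrt
  rw [hsq]
  -- For `cos θ < 1` the arguments are `0` and `π`, and `-i · i = 1`. At `cos θ = 1` the second
  -- argument is that of `0`, but the modulus vanishes.
  rcases h2.eq_or_lt with h | h
  · have : Real.sin θ = 0 := by
      have h' : Real.cos θ = 1 := by linarith
      have := Real.sin_sq_add_cos_sq θ
      rw [h'] at this
      exact pow_eq_zero_iff two_ne_zero |>.1 (by linarith)
    simp [this]
  · rw [← Complex.ofReal_add, ← Complex.ofReal_sub, Complex.arg_ofReal_of_nonneg h1,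
      Complex.arg_ofReal_of_neg h]
    have : Complex.exp (Complex.I * ((0 + Real.pi) / 2 : ℝ)) = Complex.I := by
      rw [zero_add, mul_comm]
      push_cast
      exact Complex.exp_pi_div_two_mul_I
    rw [this]
    linear_combination -(Real.sin θ : ℂ) * Complex.I_sq

theorem map_conj_legendreP (n : ℕ) : (legendreP n).map (starRingEnd ℂ) = legendreP n := by
  have h : starRingEnd ℂ 2 = 2 := map_ofNat _ 2
  simp [legendreP, ← iterate_derivative_map, h]

theorem conj_eval_iterate_derivative_legendreP (n k : ℕ) (w : ℂ) :
    starRingEnd ℂ ((derivative^[k] (legendreP n)).eval w) =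
      (derivative^[k] (legendreP n)).eval (starRingEnd ℂ w) := by
  rw [← eval₂_hom, ← eval_map, ← iterate_derivative_map, map_conj_legendreP]

theorem conj_normLegendreAt (n : ℕ) (m : ℤ) (s w : ℝ) :
    starRingEnd ℂ (normLegendreAt n m s w) = normLegendreAt n m s w := by
  have h := conj_eval_iterate_derivative_legendreP n m.natAbs w
  rw [Complex.conj_ofReal] at h
  unfold normLegendreAt assocLegendre
  split_ifs <;> simp [h]

/-! ### Spherical harmonics and plane waves. -/

/-- The two normalizing roots multiply to their radicand. For `m < 0` its factorial ratio is
inverted and cancels one of the two ratios from `assocLegendre`, so the result is even in `m`. -/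
theorem normLegendreAt_mul {n : ℕ} {m : ℤ} (hm : m ∈ Finset.Icc (-(n : ℤ)) n) (s w σ c : ℂ) :
    normLegendreAt n m σ c * normLegendreAt n m s w =
      (2 * n + 1) / (4 * Real.pi) * additionCoeff n s w σ c m := by
  rw [Finset.mem_Icc] at hm
  have hsq (x : ℝ) (hx : 0 ≤ x) : (Real.sqrt x : ℂ) * (Real.sqrt x : ℂ) = (x : ℂ) := by
    rw [← Complex.ofReal_mul, Real.mul_self_sqrt hx]
  have hfac (j : ℕ) : (j.factorial : ℂ) ≠ 0 := Nat.cast_ne_zero.2 (Nat.factorial_ne_zero _)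
  have hone (k : ℕ) : ((-1 : ℂ) ^ k) * (-1) ^ k = 1 := by rw [← mul_pow]; simp
  have hzone (k : ℤ) : ((-1 : ℂ) ^ k) * (-1) ^ k = 1 := by rw [← mul_zpow]; simp
  have hS := hsq ((2 * n + 1) / (4 * Real.pi) *
      (((n - m).toNat.factorial : ℝ) / ((n + m).toNat.factorial : ℝ))) (by positivity)
  unfold normLegendreAt assocLegendre additionCoeff
  simp only
  generalize (derivative^[m.natAbs] (legendreP n)).eval w = W
  generalize (derivative^[m.natAbs] (legendreP n)).eval c = C
  have key (S A B : ℂ) (z : ℂ) (hz : z * z = 1) : z * S * A * (z * S * B) = S * S * (A * B) := by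
    linear_combination S * S * A * B * hz
  rw [key _ _ _ _ (hzone m), hS, mul_pow]
  push_cast
  split_ifs with h
  · rw [show ((n : ℤ) - m).toNat = n - m.natAbs by omega,
      show ((n : ℤ) + m).toNat = n + m.natAbs by omega]
    linear_combination (2 * n + 1) / (4 * Real.pi) *
      ((n - m.natAbs).factorial / (n + m.natAbs).factorial) *
      (s ^ m.natAbs * σ ^ m.natAbs * W * C) * hone m.natAbs
  · rw [show ((n : ℤ) - m).toNat = n + m.natAbs by omega,
      show ((n : ℤ) + m).toNat = n - m.natAbs by omega]
    have hr : ((n + m.natAbs).factorial / (n - m.natAbs).factorial : ℂ) *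
        ((n - m.natAbs).factorial / (n + m.natAbs).factorial) = 1 := by
      have h1 := hfac (n + m.natAbs)
      have h2 := hfac (n - m.natAbs)
      field_simp
    generalize ((n - m.natAbs).factorial / (n + m.natAbs).factorial : ℂ) = Q at *
    generalize ((n + m.natAbs).factorial / (n - m.natAbs).factorial : ℂ) = Q' at *
    have ho := hone m.natAbs
    generalize ((-1 : ℂ) ^ m.natAbs) = z at *
    have ho' : z * z * (z * z) = 1 := by rw [ho, one_mul]
    linear_combination (2 * n + 1) / (4 * Real.pi) * (s ^ m.natAbs * σ ^ m.natAbs * W * C) *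
      (Q * hr + Q' * Q * Q * ho')

/-- The addition theorem for spherical harmonics, for complex arguments. -/
theorem sum_normLegendreAt_mul (n : ℕ) {s w σ c h : ℂ} (hs : s ^ 2 = 1 - w ^ 2)
    (hσ : σ ^ 2 = 1 - c ^ 2) (h0 : h ≠ 0) :
    ∑ m ∈ Finset.Icc (-(n : ℤ)) n, normLegendreAt n m σ c * normLegendreAt n m s w * h ^ m =
      (2 * n + 1) / (4 * Real.pi) * (legendreP n).eval (w * c + s * σ / 2 * (h + h⁻¹)) := by
  have h1 := hasSum_sum_of_ne_finset_zero (L := SummationFilter.unconditional ℤ)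
    (f := fun m : ℤ => additionCoeff n s w σ c m * h ^ m) (s := Finset.Icc (-(n : ℤ)) n) (by
      intro m hm
      rw [Finset.mem_Icc] at hm
      rw [additionCoeff_eq_zero (by omega), zero_mul])
  rw [(hasSum_additionCoeff n hs hσ h0).unique h1, Finset.mul_sum]
  refine Finset.sum_congr rfl fun m hm => ?_
  rw [normLegendreAt_mul hm, mul_assoc]

/-- The expansion of a plane wave in products of associated Legendre functions. -/
theorem hasSum_planeWave (t : ℝ) {s w σ c h : ℂ} (hs : s ^ 2 = 1 - w ^ 2)
    (hσ : σ ^ 2 = 1 - c ^ 2) (h0 : h ≠ 0) :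
    HasSum (fun n : ℕ => ∑ m ∈ Finset.Icc (-(n : ℤ)) n,
        4 * Real.pi * (-1) ^ n * (sphBesselI n t : ℂ) *
          (normLegendreAt n m σ c * normLegendreAt n m s w * h ^ m))
      (Complex.exp (-(t * (w * c + s * σ / 2 * (h + h⁻¹))))) := by
  have hpi : (Real.pi : ℂ) ≠ 0 := Complex.ofReal_ne_zero.2 Real.pi_ne_zero
  -- The argument `-t` yields the sign `(-1)^n`, by the parity of `i_n`.
  have h1 := hasSum_sphBesselI_mul_legendreP (-t) (w * c + s * σ / 2 * (h + h⁻¹))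
  rw [Complex.ofReal_neg, neg_mul] at h1
  refine h1.congr_fun fun n => ?_
  rw [← Finset.mul_sum, sum_normLegendreAt_mul n hs hσ h0, sphBesselI_neg]
  push_cast
  field_simp

theorem coeffB_eq (lam : ℝ) (n : ℕ) (m : ℤ) (R φ : ℝ) {θ : ℝ} (hθ : θ ∈ Set.Icc 0 Real.pi) :
    coeffB lam n m R θ φ = 4 * Real.pi * (-1) ^ n * (sphBesselI n (lam * R) : ℂ) *
      normLegendreAt n m (Real.sin θ : ℂ) (Real.cos θ : ℂ) * Complex.exp (Complex.I * m * φ) := by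
  rw [coeffB, sphHarmonic, normLegendre, branchSqrt_one_cos hθ]
  ring

theorem conj_coeffB_eq (lam : ℝ) (n : ℕ) (m : ℤ) (R φ : ℝ) {θ : ℝ}
    (hθ : θ ∈ Set.Icc 0 Real.pi) :
    starRingEnd ℂ (coeffB lam n m R θ φ) =
      4 * Real.pi * (-1) ^ n * (sphBesselI n (lam * R) : ℂ) *
        normLegendreAt n m (Real.sin θ : ℂ) (Real.cos θ : ℂ) *
          Complex.exp (-(Complex.I * m * φ)) := by
  rw [coeffB_eq _ _ _ _ _ hθ, map_mul, map_mul, conj_normLegendreAt, ← Complex.exp_conj]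
  have h : starRingEnd ℂ 4 = 4 := map_ofNat _ 4
  simp [h]

theorem dot_waveVector {r : EuclideanSpace ℝ (Fin 3)} {R θ φ : ℝ}
    (hr : IsSphericalCoords r R θ φ) {lam : ℝ} (hlam : 0 < lam) (α : ℝ) (ρ z : ℂ) {h : ℂ}
    (hh : h + h⁻¹ = 2 * Real.cos (φ - α)) :
    dot (waveVector α ρ z) r = -((lam * R : ℝ) * (z / lam * (Real.cos θ : ℂ) +
      (-Complex.I * ρ / lam) * (Real.sin θ : ℂ) / 2 * (h + h⁻¹))) := by
  obtain ⟨-, -, h0, h1, h2⟩ := hr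
  have hl : (lam : ℂ) ≠ 0 := Complex.ofReal_ne_zero.2 hlam.ne'
  rw [hh, Real.cos_sub, dot, Fin.sum_univ_three, h0, h1, h2]
  simp only [waveVector, Matrix.cons_val_zero, Matrix.cons_val_one, Matrix.cons_val]
  push_cast
  field_simp
  ring

theorem exp_I_mul_add_inv (x : ℝ) :
    Complex.exp (Complex.I * x) + (Complex.exp (Complex.I * x))⁻¹ = 2 * Real.cos x := by
  rw [← Complex.exp_neg, Complex.ofReal_cos, Complex.two_cos, mul_comm, neg_mul]

theorem hasSum_exp_dot_waveVector {lam : ℝ} (hlam : 0 < lam) (α : ℝ)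
    {r : EuclideanSpace ℝ (Fin 3)} {R θ φ : ℝ} (hr : IsSphericalCoords r R θ φ)
    {lamρ lamz : ℂ} (hz : lamz ^ 2 = (lam : ℂ) ^ 2 + lamρ ^ 2) :
    HasSum (fun n : ℕ => ∑ m ∈ Finset.Icc (-(n : ℤ)) n,
          (starRingEnd ℂ) (coeffB lam n m R θ φ) *
            normLegendreAt n m (-Complex.I * lamρ / lam) (lamz / lam) *
            Complex.exp (Complex.I * m * α))
        (Complex.exp (dot (waveVector α lamρ lamz) r)) ∧
      HasSum (fun n : ℕ => ∑ m ∈ Finset.Icc (-(n : ℤ)) n,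
          coeffB lam n m R θ φ *
            normLegendreAt n m (-Complex.I * lamρ / lam) (lamz / lam) *
            Complex.exp (-(Complex.I * m * α)))
        (Complex.exp (dot (waveVector α lamρ lamz) r)) := by
  have hl : (lam : ℂ) ≠ 0 := Complex.ofReal_ne_zero.2 hlam.ne'
  have hs : (-Complex.I * lamρ / lam) ^ 2 = 1 - (lamz / lam) ^ 2 := by
    rw [div_pow, div_pow, hz, mul_pow, neg_sq, Complex.I_sq]
    field_simp
    ring
  have hσ : (Real.sin θ : ℂ) ^ 2 = 1 - (Real.cos θ : ℂ) ^ 2 := by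
    exact_mod_cast Real.sin_sq θ
  have hθ := hr.2.1
  constructor
  -- The exponent depends on `h` only through `h + h⁻¹`: `h = e^{i(α-φ)}` gives the conjugated
  -- expansion, its inverse the other one.
  · have hh : Complex.exp (Complex.I * (α - φ : ℝ)) + (Complex.exp (Complex.I * (α - φ : ℝ)))⁻¹ =
        2 * Real.cos (φ - α) := by
      rw [exp_I_mul_add_inv, ← Real.cos_neg, neg_sub]
    rw [dot_waveVector hr hlam α lamρ lamz hh]
    refine (hasSum_planeWave (lam * R) hs hσ (Complex.exp_ne_zero _)).congr_fun fun n =>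
      Finset.sum_congr rfl fun m _ => ?_
    have e : Complex.exp (Complex.I * (α - φ : ℝ)) ^ m =
        Complex.exp (-(Complex.I * m * φ)) * Complex.exp (Complex.I * m * α) := by
      rw [← Complex.exp_int_mul, ← Complex.exp_add]
      congr 1
      push_cast
      ring
    rw [e, conj_coeffB_eq _ _ _ _ _ hθ]
    ring
  · have hh := exp_I_mul_add_inv (φ - α)
    rw [dot_waveVector hr hlam α lamρ lamz hh]
    refine (hasSum_planeWave (lam * R) hs hσ (Complex.exp_ne_zero _)).congr_fun fun n =>
      Finset.sum_congr rfl fun m _ => ?_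
    have e : Complex.exp (Complex.I * (φ - α : ℝ)) ^ m =
        Complex.exp (Complex.I * m * φ) * Complex.exp (-(Complex.I * m * α)) := by
      rw [← Complex.exp_int_mul, ← Complex.exp_add]
      congr 1
      push_cast
      ring
    rw [e, coeffB_eq _ _ _ _ _ hθ]
    ring

end FunkHecke

open FunkHecke

theorem mainTheorem1 (lam : ℝ) (hlam : 0 < lam) (α : ℝ) (hα : α ∈ Set.Ico 0 (2 * Real.pi))
    (r : EuclideanSpace ℝ (Fin 3)) (R θ φ : ℝ) (hr : IsSphericalCoords r R θ φ)
    (lamρ lamz : ℂ) (hz : lamz ^ 2 = (lam : ℂ) ^ 2 + lamρ ^ 2) :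
    -- square roots of `λ_z² - λ²` and of `1 - (λ_z / λ)²` on the branch
    (HasSum (fun n : ℕ => ∑ m ∈ Finset.Icc (-(n : ℤ)) n,
          (starRingEnd ℂ) (coeffB lam n m R θ φ) * normLegendre n m (lamz / lam) *
            Complex.exp (Complex.I * m * α))
        (Complex.exp (dot (waveVector α (Complex.I * branchSqrt lam lamz) lamz) r)) ∧
      HasSum (fun n : ℕ => ∑ m ∈ Finset.Icc (-(n : ℤ)) n,
          coeffB lam n m R θ φ * normLegendre n m (lamz / lam) *
            Complex.exp (-(Complex.I * m * α)))
        (Complex.exp (dot (waveVector α (Complex.I * branchSqrt lam lamz) lamz) r))) ∧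
    -- the same with the roots `λ_ρ` and `-i λ_ρ / λ`
    (HasSum (fun n : ℕ => ∑ m ∈ Finset.Icc (-(n : ℤ)) n,
          (starRingEnd ℂ) (coeffB lam n m R θ φ) *
            normLegendreAt n m (-Complex.I * lamρ / lam) (lamz / lam) *
            Complex.exp (Complex.I * m * α))
        (Complex.exp (dot (waveVector α lamρ lamz) r)) ∧
      HasSum (fun n : ℕ => ∑ m ∈ Finset.Icc (-(n : ℤ)) n,
          coeffB lam n m R θ φ *
            normLegendreAt n m (-Complex.I * lamρ / lam) (lamz / lam) *
            Complex.exp (-(Complex.I * m * α)))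
        (Complex.exp (dot (waveVector α lamρ lamz) r))) := by
  refine ⟨?_, hasSum_exp_dot_waveVector hlam α hr hz⟩
  -- The branch value is an admissible `λ_ρ`, and its `-iλ_ρ/λ` is exactly the root used by
  -- `normLegendre`.
  have hz' : lamz ^ 2 = (lam : ℂ) ^ 2 + (Complex.I * branchSqrt lam lamz) ^ 2 := by
    rw [mul_pow, Complex.I_sq, branchSqrt_sq]
    ring
  have e : -Complex.I * (Complex.I * branchSqrt lam lamz) / lam = branchSqrt 1 (lamz / lam) := by
    rw [branchSqrt_div hlam, ← mul_assoc, neg_mul, Complex.I_mul_I, neg_neg, one_mul]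
  have h := hasSum_exp_dot_waveVector hlam α hr hz'
  rw [e] at h
  exact h
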